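/- Let $\mathsf h$ be a separable complex Hilbert space, $\{e_i\}_i$ an orthonormal basis of $\mathsf h$, $\theta$ the antiunitary conjugation $\theta\sum_i u_i e_i=\sum_i\bar u_i e_i$, $\Theta(x)=\theta x^*\theta$ for $x\in\mathcal B(\mathsf h)$, and $\rho$ a density operator (positive, trace class, $\mathsf{tr}\,\rho=1$). For a bounded completely positive map $\Phi_*$ on the trace class operators $L_1(\mathsf h)$, let $\mathcal J_\rho(\Phi_*)=(1\otimes\Phi_*)(\omega_\rho)$ be its $\rho$-Choi–Jamiołkowski operator, i.e. the bounded operator on $\mathsf h\otimes\mathsf h$ with $$\langle e_k\otimes e_l,\ \mathcal J_\rho(\Phi_*)\, e_{m}\otimes e_{n}\rangle=\langle e_l,\ \Phi_*(|\rho^{1/2}e_k\rangle\langle\rho^{1/2}e_m|)\,e_n\rangle\quad\text{for all }k,l,m,n .$$ (1) Let $\Phi_*$ be a bounded completely positive map on $L_1(\mathsf h)$ and let $\Phi$ be its dual on $\mathcal B(\mathsf h)$, $\mathsf{tr}(\Phi_*(\sigma)x)=\mathsf{tr}(\sigma\Phi(x))$. Then $\mathcal J_\rho(\Phi_*)$ is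 well defined, positive and trace class, and the forward functional $\overrightarrow\omega_\rho(\Phi_*)(x)=\mathsf{tr}(\mathcal J_\rho(\Phi_*)x)$ on $\mathcal B(\mathsf h\otimes\mathsf h)$ satisfies $$\overrightarrow\omega_\rho(\Phi_*)(a\otimes b)=\mathsf{tr}\big(\rho^{1/2}\theta a^*\theta\rho^{1/2}\Phi(b)\big)\quad\text{for all }a,b\in\mathcal B(\mathsf h).$$ If moreover $\Phi$ has a $\Theta$-KMS adjoint $\Phi^\Theta$, i.e. $\Phi^\Theta$ is the dual of a bounded completely positive map $\Phi^\Theta_*$ on $L_1(\mathsf h)$ and $$\mathsf{tr}\big(\rho^{1/2}\Theta(x^*)\rho^{1/2}\Phi(y)\big)=\mathsf{tr}\big(\rho^{1/2}\Theta(\Phi^\Theta(x^*))\rho^{1/2}y\big)\quad\text{for all }x,y\in\mathcal B(\mathsf h),$$ then the backward functional $\overleftarrow\omega_\rho(\Phi_*)(x)=\mathsf{tr}(\mathcal J_\rho(\Phi^\Theta_*)x)$ satisfies $$\overleftarrow\omega_\rho(\Phi_*)(a\otimes b)=\mathsf{tr}\big(\rho^{1/2}\theta a^*\theta\rho^{1/2}\Phi^\Theta(b)\big)\quad\text{for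 all }a,b\in\mathcal B(\mathsf h).$$ (2) Let $(\mathcal T_t)_{t\ge0}$ be a uniformly continuous quantum Markov semigroup on $\mathcal B(\mathsf h)$ (normal, completely positive, unital), suppose that $\rho$ is faithful and invariant, and let $(\mathcal T^\Theta_t)_{t\ge0}$ be a uniformly continuous quantum Markov semigroup such that $\mathcal T^\Theta_t$ satisfies the above duality relation with respect to $\mathcal T_t$ for every $t\ge 0$. Let $\mathcal T_{*t}$, $\mathcal T^\Theta_{*t}$ be the predual semigroups. Then for every $t\ge0$ the operator $\mathcal J_\rho(\mathcal T_{*t})$ (respectively $\mathcal J_\rho(\mathcal T^\Theta_{*t})$) is a density operator, and it is the only trace class operator $D$ on $\mathsf h\otimes\mathsf h$ such that $\mathsf{tr}(D\,(a\otimes b))=\mathsf{tr}(\rho^{1/2}\theta a^*\theta\rho^{1/2}\mathcal T_t(b))$ (respectively $=\mathsf{tr}(\rho^{1/2}\theta a^*\theta\rho^{1/2}\mathcal T^\Theta_t(b))$) for all $a,b\in\mathcal B(\mathsf h)$. If in addition the $e_i$ are eigenvectors of $\rho$, then $\mathcal J_\rho(\mathcal T^\Theta_{*t})$ is also the density of the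 backward two-point state $$\overleftarrow\Omega_t(a\otimes b)=\mathsf{tr}\big(\rho^{1/2}\theta\,\mathcal T_t(a^*)\,\theta\rho^{1/2}b\big),$$ i.e. it is the only trace class operator $D$ with $\mathsf{tr}(D\,(a\otimes b))=\overleftarrow\Omega_t(a\otimes b)$ for all $a,b\in\mathcal B(\mathsf h)$. -/

import Mathlib

open scoped ComplexOrder InnerProductSpace TensorProduct NNReal ENNReal

noncomputable section

namespace ChoiJamiolkowski

section TraceClass
variable {E : Type*} [NormedAddCommGroup E] [InnerProductSpace ℂ E] [CompleteSpace E]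

/-- An index set of a fixed orthonormal basis of `E`. -/
def stdIndex (E : Type*) [NormedAddCommGroup E] [InnerProductSpace ℂ E] [CompleteSpace E] :
    Set E := (exists_hilbertBasis ℂ E).choose

/-- A fixed orthonormal basis of `E`. -/
def stdHilbertBasis (E : Type*) [NormedAddCommGroup E] [InnerProductSpace ℂ E] [CompleteSpace E] :
    HilbertBasis (stdIndex E) ℂ E := (exists_hilbertBasis ℂ E).choose_spec.choose

/-- `tr A = ∑ᵢ ⟨bᵢ, A bᵢ⟩`. For a trace class `A` it does not depend on the orthonormal basis. -/
def opTrace (A : E →L[ℂ] E) : ℂ :=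
  ∑' i, ⟪stdHilbertBasis E i, A (stdHilbertBasis E i)⟫_ℂ

/-- `A` is trace class: `tr |A| = ∑ᵢ ⟨bᵢ, |A| bᵢ⟩ < ∞`, where `|A| = (A^* A)^{1/2}`. -/
def IsTraceClass (A : E →L[ℂ] E) : Prop :=
  Summable fun i => ⟪stdHilbertBasis E i, CFC.abs A (stdHilbertBasis E i)⟫_ℂ

/-- The trace norm `‖A‖₁ = tr |A|`. -/
def traceNorm (A : E →L[ℂ] E) : ℝ := (opTrace (CFC.abs A)).re

/-- The square of the Hilbert–Schmidt norm. -/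
def hs (T : E →L[ℂ] E) : ℝ≥0∞ := ∑' i, ‖T (stdHilbertBasis E i)‖ₑ ^ 2

lemma enorm_sq_eq_tsum {ι : Type*} (b : HilbertBasis ι ℂ E) (x : E) :
    ‖x‖ₑ ^ 2 = ∑' i, ‖⟪b i, x⟫_ℂ‖ₑ ^ 2 := by
  have h := b.hasSum_inner_mul_inner x x
  have h2 : HasSum (fun i => ‖⟪b i, x⟫_ℂ‖ ^ 2) (‖x‖ ^ 2) := by
    have h3 := Complex.hasSum_re h
    convert! h3 using 2 with i
    · rw [← inner_conj_symm x (b i), ← Complex.normSq_eq_conj_mul_self, Complex.ofReal_re,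
        Complex.normSq_eq_norm_sq]
    · rw [inner_self_eq_norm_sq_to_K]; norm_cast
  have h4 : ∀ r : ℂ, ‖r‖ₑ ^ 2 = ENNReal.ofReal (‖r‖ ^ 2) := fun r => by
    rw [← ofReal_norm, ENNReal.ofReal_pow (norm_nonneg _)]
  simp_rw [h4]
  rw [← ENNReal.ofReal_tsum_of_nonneg (fun _ => by positivity) h2.summable, h2.tsum_eq,
    ← ofReal_norm, ENNReal.ofReal_pow (norm_nonneg _)]

lemma hs_adjoint (T : E →L[ℂ] E) : hs (ContinuousLinearMap.adjoint T) = hs T := by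
  unfold hs
  simp_rw [enorm_sq_eq_tsum (stdHilbertBasis E)]
  rw [ENNReal.tsum_comm]
  congr! 5 with i j
  rw [ContinuousLinearMap.adjoint_inner_right, ← inner_conj_symm, RCLike.enorm_conj]

lemma hs_comp_ne_top (X T : E →L[ℂ] E) (h : hs T ≠ ∞) : hs (X * T) ≠ ∞ := by
  have : hs (X * T) ≤ ‖X‖ₑ ^ 2 * hs T := by
    unfold hs
    rw [← ENNReal.tsum_mul_left]
    refine ENNReal.tsum_le_tsum fun i => ?_
    rw [← mul_pow]
    gcongr
    exact X.le_opENorm _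
  exact ne_top_of_le_ne_top (ENNReal.mul_ne_top (by simp) h) this

lemma summable_of_hs {T : E →L[ℂ] E} (h : hs T ≠ ∞) :
    Summable fun i => ‖T (stdHilbertBasis E i)‖ ^ 2 := by
  have := ENNReal.summable_toReal h
  simpa using this

lemma hs_ne_top_of_summable {T : E →L[ℂ] E}
    (h : Summable fun i => ‖T (stdHilbertBasis E i)‖ ^ 2) : hs T ≠ ∞ := by
  have := h.tsum_ofReal_ne_top
  have h2 : hs T = ∑' i, ENNReal.ofReal (‖T (stdHilbertBasis E i)‖ ^ 2) := by
    unfold hs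
    refine tsum_congr fun i => ?_
    rw [← ofReal_norm, ENNReal.ofReal_pow (norm_nonneg _)]
  rwa [h2]

lemma inner_sqrt {P : E →L[ℂ] E} (hP : 0 ≤ P) (x : E) :
    ⟪x, P x⟫_ℂ = ((‖CFC.sqrt P x‖ ^ 2 : ℝ) : ℂ) := by
  have hs : ContinuousLinearMap.adjoint (CFC.sqrt P) = CFC.sqrt P :=
    (IsSelfAdjoint.of_nonneg (CFC.sqrt_nonneg P))
  conv_lhs => rw [← CFC.sqrt_mul_sqrt_self P hP]
  rw [mul_apply_eq_comp, ← ContinuousLinearMap.adjoint_inner_left, hs,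
    inner_self_eq_norm_sq_to_K]
  norm_cast

/-- If `P ≥ 0` has finite trace, then `∑ᵢ ⟨bᵢ, X P bᵢ⟩` converges for every bounded `X`. -/
lemma summable_inner_mul {P : E →L[ℂ] E} (hP : 0 ≤ P)
    (h : Summable fun i => ⟪stdHilbertBasis E i, P (stdHilbertBasis E i)⟫_ℂ) (X : E →L[ℂ] E) :
    Summable fun i => ⟪stdHilbertBasis E i, (X * P) (stdHilbertBasis E i)⟫_ℂ := by
  have hs' : ContinuousLinearMap.adjoint (CFC.sqrt P) = CFC.sqrt P :=
    (IsSelfAdjoint.of_nonneg (CFC.sqrt_nonneg P))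
  have h1 : Summable fun i => ‖CFC.sqrt P (stdHilbertBasis E i)‖ ^ 2 := by
    simp_rw [inner_sqrt hP] at h
    exact_mod_cast h
  have h2 : hs (CFC.sqrt P) ≠ ∞ := hs_ne_top_of_summable h1
  have h3 : hs (CFC.sqrt P * ContinuousLinearMap.adjoint X) ≠ ∞ := by
    rw [← hs_adjoint]
    have : ContinuousLinearMap.adjoint (CFC.sqrt P * ContinuousLinearMap.adjoint X) =
        X * CFC.sqrt P := by
      rw [ContinuousLinearMap.mul_def, ContinuousLinearMap.adjoint_comp, hs',
        ContinuousLinearMap.adjoint_adjoint]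
      rfl
    rw [this]
    exact hs_comp_ne_top _ _ h2
  refine Summable.of_norm_bounded (((summable_of_hs h3).add h1)) fun i => ?_
  have : ⟪stdHilbertBasis E i, (X * P) (stdHilbertBasis E i)⟫_ℂ =
      ⟪(CFC.sqrt P * ContinuousLinearMap.adjoint X) (stdHilbertBasis E i),
        CFC.sqrt P (stdHilbertBasis E i)⟫_ℂ := by
    conv_lhs => rw [← CFC.sqrt_mul_sqrt_self P hP]
    simp only [mul_apply_eq_comp]
    rw [← ContinuousLinearMap.adjoint_inner_left, ← ContinuousLinearMap.adjoint_inner_left, hs']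
  rw [this]
  refine (norm_inner_le_norm _ _).trans ?_
  nlinarith [sq_nonneg (‖(CFC.sqrt P * ContinuousLinearMap.adjoint X) (stdHilbertBasis E i)‖ -
    ‖CFC.sqrt P (stdHilbertBasis E i)‖), sq_nonneg ‖(CFC.sqrt P * ContinuousLinearMap.adjoint X)
    (stdHilbertBasis E i)‖, sq_nonneg ‖CFC.sqrt P (stdHilbertBasis E i)‖]

/-- If `‖S x‖ = ‖T x‖` for all `x`, then `S = W T` for a bounded `W`. -/
lemma exists_factor (S T : E →L[ℂ] E) (h : ∀ x, ‖S x‖ = ‖T x‖) : ∃ W : E →L[ℂ] E, S = W * T := by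
  set K : Submodule ℂ E := (LinearMap.range T.toLinearMap).topologicalClosure
  have hK : CompleteSpace K :=
    (Submodule.isClosed_topologicalClosure _).completeSpace_coe
  let T' : E →ₗ[ℂ] K := T.toLinearMap.codRestrict K fun x =>
    Submodule.le_topologicalClosure _ ⟨x, rfl⟩
  have hd : DenseRange T' := by
    rw [DenseRange, dense_iff_closure_eq, Set.eq_univ_iff_forall]
    intro y
    rw [closure_subtype]
    have : ((↑) '' Set.range T' : Set E) = LinearMap.range T.toLinearMap := by
      ext z; simp [T']
    rw [this]
    exact y.2
  let G : K →L[ℂ] E := S.toLinearMap.extendOfNorm T'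
  refine ⟨G.comp K.orthogonalProjectionOnto, ?_⟩
  ext x
  have h1 : K.orthogonalProjectionOnto (T x) = T' x :=
    Submodule.orthogonalProjectionOnto_mem_subspace_eq_self (T' x)
  have h2 : G (T' x) = S x :=
    LinearMap.extendOfNorm_eq (f := S.toLinearMap) hd ⟨1, fun x => by
      have : ‖T' x‖ = ‖T x‖ := rfl
      simp [this, h x]⟩ x
  simp [h1, h2]

lemma norm_abs_apply (A : E →L[ℂ] E) (x : E) : ‖CFC.abs A x‖ = ‖A x‖ := by
  have hs : ContinuousLinearMap.adjoint (CFC.abs A) = CFC.abs A :=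
    (IsSelfAdjoint.of_nonneg (CFC.abs_nonneg A))
  have h : ⟪CFC.abs A x, CFC.abs A x⟫_ℂ = ⟪A x, A x⟫_ℂ := by
    rw [← ContinuousLinearMap.adjoint_inner_right, hs, ← mul_apply_eq_comp,
      CFC.abs_mul_abs, mul_apply_eq_comp, ContinuousLinearMap.star_eq_adjoint,
      ContinuousLinearMap.adjoint_inner_right]
  rw [inner_self_eq_norm_sq_to_K, inner_self_eq_norm_sq_to_K] at h
  have h' : ‖CFC.abs A x‖ ^ 2 = ‖A x‖ ^ 2 := by exact_mod_cast h
  exact (sq_eq_sq₀ (norm_nonneg _) (norm_nonneg _)).1 h'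

lemma exists_abs_eq (A : E →L[ℂ] E) : ∃ W : E →L[ℂ] E, CFC.abs A = W * A :=
  exists_factor _ _ (norm_abs_apply A)

lemma exists_eq_abs (A : E →L[ℂ] E) : ∃ W : E →L[ℂ] E, A = W * CFC.abs A :=
  exists_factor _ _ fun x => (norm_abs_apply A x).symm

lemma IsTraceClass.summable_mul {A : E →L[ℂ] E} (h : IsTraceClass A) (X : E →L[ℂ] E) :
    Summable fun i => ⟪stdHilbertBasis E i, (X * A) (stdHilbertBasis E i)⟫_ℂ := by
  obtain ⟨W, hW⟩ := exists_eq_abs A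
  rw [hW, ← mul_assoc]
  exact summable_inner_mul (CFC.abs_nonneg A) h _

lemma isTraceClass_of_summable_mul {A : E →L[ℂ] E}
    (h : ∀ X : E →L[ℂ] E,
      Summable fun i => ⟪stdHilbertBasis E i, (X * A) (stdHilbertBasis E i)⟫_ℂ) :
    IsTraceClass A := by
  obtain ⟨W, hW⟩ := exists_abs_eq A
  rw [IsTraceClass, hW]
  exact h W

lemma IsTraceClass.mul_left {A : E →L[ℂ] E} (h : IsTraceClass A) (X : E →L[ℂ] E) :
    IsTraceClass (X * A) :=
  isTraceClass_of_summable_mul fun Y => by simpa [mul_assoc] using h.summable_mul (Y * X)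

variable (E) in
/-- `L₁(E)`, the space of trace class operators. -/
def L1 : Submodule ℂ (E →L[ℂ] E) where
  carrier := {A | IsTraceClass A}
  zero_mem' := isTraceClass_of_summable_mul fun X => by simp
  add_mem' {A B} hA hB := isTraceClass_of_summable_mul fun X => by
    simpa [mul_add, inner_add_right] using (hA.summable_mul X).add (hB.summable_mul X)
  smul_mem' c A hA := isTraceClass_of_summable_mul fun X => by
    simpa [inner_smul_right] using (hA.summable_mul X).mul_left c

lemma isTraceClass_rankOne (x y : E) : IsTraceClass (InnerProductSpace.rankOne ℂ x y) := by
  refine isTraceClass_of_summable_mul fun X => ?_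
  have := (stdHilbertBasis E).summable_inner_mul_inner y (X x)
  simpa [inner_smul_right] using this

/-- The trace class operator `|x⟩⟨y|`. -/
def ketBra (x y : E) : L1 E := ⟨InnerProductSpace.rankOne ℂ x y, isTraceClass_rankOne x y⟩

end TraceClass

/-! ### States -/

section States
variable {E : Type*} [NormedAddCommGroup E] [InnerProductSpace ℂ E] [CompleteSpace E]

/-- A state, given by its density operator: positive, trace class, of trace one. -/
structure IsDensityOperator (ρ : E →L[ℂ] E) : Prop where
  nonneg : 0 ≤ ρ
  traceClass : IsTraceClass ρ
  trace_eq_one : opTrace ρ = 1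

/-- The state `x ↦ tr (ρ x)` is faithful. -/
def IsFaithful (ρ : E →L[ℂ] E) : Prop :=
  ∀ x : E →L[ℂ] E, 0 ≤ x → opTrace (ρ * x) = 0 → x = 0

/-- `e` is a basis of eigenvectors of `ρ`. -/
def Diagonalizes {ι : Type*} (e : HilbertBasis ι ℂ E) (ρ : E →L[ℂ] E) : Prop :=
  ∀ i, ∃ r : ℝ, ρ (e i) = (r : ℂ) • e i

end States

/-! ### The conjugation and the reversing operation -/

section Conjugation
variable {H : Type*} [NormedAddCommGroup H] [InnerProductSpace ℂ H]

/-- The antiunitary conjugation `θ (∑ᵢ uᵢ eᵢ) = ∑ᵢ conj uᵢ eᵢ` with respect to the basis `e`. -/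
def conjugation {ι : Type*} (e : HilbertBasis ι ℂ H) : H ≃ₗᵢ⋆[ℂ] H :=
  (e.repr.trans (starₗᵢ ℂ)).trans e.repr.symm

/-- The (linear) operator `θ x θ`. -/
def sandwich (θ : H ≃ₗᵢ⋆[ℂ] H) (x : H →L[ℂ] H) : H →L[ℂ] H :=
  (θ : H →L⋆[ℂ] H).comp (x.comp (θ : H →L⋆[ℂ] H))

/-- The reversing operation `Θ(x) = θ x^* θ`. -/
def reversing [CompleteSpace H] (θ : H ≃ₗᵢ⋆[ℂ] H) (x : H →L[ℂ] H) : H →L[ℂ] H :=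
  sandwich θ (star x)

end Conjugation

/-! ### The Hilbert space tensor product -/

section Tensor

/-- The Hilbert space tensor product `H ⊗ H`: the completion of the algebraic tensor product for
`⟪u ⊗ v, u' ⊗ v'⟫ = ⟪u, u'⟫ ⟪v, v'⟫`. -/
def HilbertTensor (H : Type*) [NormedAddCommGroup H] [InnerProductSpace ℂ H] : Type _ :=
  UniformSpace.Completion (H ⊗[ℂ] H)

variable {H : Type*} [NormedAddCommGroup H] [InnerProductSpace ℂ H]

instance : NormedAddCommGroup (HilbertTensor H) :=
  inferInstanceAs (NormedAddCommGroup (UniformSpace.Completion (H ⊗[ℂ] H)))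

instance : InnerProductSpace ℂ (HilbertTensor H) :=
  inferInstanceAs (InnerProductSpace ℂ (UniformSpace.Completion (H ⊗[ℂ] H)))

instance : CompleteSpace (HilbertTensor H) :=
  inferInstanceAs (CompleteSpace (UniformSpace.Completion (H ⊗[ℂ] H)))

/-- The simple tensor `u ⊗ v`. -/
def tmul (u v : H) : HilbertTensor H :=
  ((u ⊗ₜ[ℂ] v : H ⊗[ℂ] H) : UniformSpace.Completion (H ⊗[ℂ] H))

/-- The bounded operator `a ⊗ b` on `H ⊗ H`. -/
def opTensor (a b : H →L[ℂ] H) : HilbertTensor H →L[ℂ] HilbertTensor H :=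
  (TensorProduct.mapL a b).completion

lemma inner_tmul (u v u' v' : H) :
    ⟪tmul u v, tmul u' v'⟫_ℂ = ⟪u, u'⟫_ℂ * ⟪v, v'⟫_ℂ :=
  (UniformSpace.Completion.inner_coe _ _).trans (TensorProduct.inner_tmul ℂ u u' v v')

lemma opTensor_tmul (a b : H →L[ℂ] H) (u v : H) :
    opTensor a b (tmul u v) = tmul (a u) (b v) :=
  (TensorProduct.mapL a b).completion_apply_coe (u ⊗ₜ[ℂ] v)

lemma dense_span_tmul :
    Dense (Submodule.span ℂ (Set.range fun p : H × H => tmul p.1 p.2) : Set (HilbertTensor H)) := by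
  have hd : DenseRange ((↑) : H ⊗[ℂ] H → UniformSpace.Completion (H ⊗[ℂ] H)) :=
    UniformSpace.Completion.denseRange_coe
  refine Dense.mono ?_ hd
  rintro _ ⟨x, rfl⟩
  induction x using TensorProduct.induction_on with
  | zero => exact Submodule.zero_mem _
  | tmul u v => exact Submodule.subset_span ⟨(u, v), rfl⟩
  | add x y hx hy =>
    rw [UniformSpace.Completion.coe_add]
    exact Submodule.add_mem _ hx hy

end Tensor

/-! ### Completely positive maps, preduals, adjoints -/

section Maps
variable {H : Type*} [NormedAddCommGroup H] [InnerProductSpace ℂ H] [CompleteSpace H]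

/-- `Φ_*` is bounded for the trace norm. -/
def IsBoundedL1 (Φs : L1 H →ₗ[ℂ] L1 H) : Prop :=
  ∃ C : ℝ, ∀ σ : L1 H, traceNorm (Φs σ : H →L[ℂ] H) ≤ C * traceNorm (σ : H →L[ℂ] H)

/-- `Φ_*` is completely positive: if the operator matrix `(X i j)` with trace class entries is
positive on `H^n`, then so is `(Φ_* (X i j))`. -/
def IsCPL1 (Φs : L1 H →ₗ[ℂ] L1 H) : Prop :=
  ∀ (n : ℕ) (X : Fin n → Fin n → L1 H),
    (∀ v : Fin n → H, 0 ≤ ∑ i, ∑ j, ⟪v i, (X i j : H →L[ℂ] H) (v j)⟫_ℂ) →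
      ∀ v : Fin n → H, 0 ≤ ∑ i, ∑ j, ⟪v i, (Φs (X i j) : H →L[ℂ] H) (v j)⟫_ℂ

/-- `Φ_*` is the predual of `Φ`, i.e. `Φ` is the dual of `Φ_*`:
`tr (Φ_*(σ) x) = tr (σ Φ(x))` for all `σ ∈ L₁(H)`, `x ∈ B(H)`. -/
def IsPredual (Φs : L1 H →ₗ[ℂ] L1 H) (Φ : (H →L[ℂ] H) →L[ℂ] (H →L[ℂ] H)) : Prop :=
  ∀ (σ : L1 H) (x : H →L[ℂ] H),
    opTrace ((Φs σ : H →L[ℂ] H) * x) = opTrace ((σ : H →L[ℂ] H) * Φ x)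

/-- The `Θ`-KMS duality relation between `Φ` and `Φ^Θ` with respect to `ρ`. -/
def IsThetaKMSAdjoint (θ : H ≃ₗᵢ⋆[ℂ] H) (ρ : H →L[ℂ] H)
    (Φ ΦΘ : (H →L[ℂ] H) →L[ℂ] (H →L[ℂ] H)) : Prop :=
  ∀ x y : H →L[ℂ] H,
    opTrace (CFC.sqrt ρ * reversing θ (star x) * CFC.sqrt ρ * Φ y) =
      opTrace (CFC.sqrt ρ * reversing θ (ΦΘ (star x)) * CFC.sqrt ρ * y)

variable (H) in
/-- A uniformly continuous quantum Markov semigroup on `B(H)`, together with its (uniquely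
determined) predual semigroup. Complete positivity is Mathlib's notion for `C^*`-algebras; the
existence of the bounded predual of each `T t` says that `T t` is normal. -/
structure UniformlyContinuousQMS where
  /-- The semigroup on `B(H)`. -/
  T : ℝ≥0 → (H →L[ℂ] H) →L[ℂ] (H →L[ℂ] H)
  /-- The predual semigroup on `L₁(H)`. -/
  predual : ℝ≥0 → L1 H →ₗ[ℂ] L1 H
  map_zero : T 0 = ContinuousLinearMap.id ℂ (H →L[ℂ] H)
  map_add : ∀ s t, T (s + t) = (T s).comp (T t)
  map_one : ∀ t, T t 1 = 1
  cp : ∀ t, ∃ φ : CompletelyPositiveMap (H →L[ℂ] H) (H →L[ℂ] H), ∀ x, φ x = T t x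
  predual_bounded : ∀ t, IsBoundedL1 (predual t)
  isPredual : ∀ t, IsPredual (predual t) (T t)
  continuous : Continuous T

/-- `ρ` is invariant: `tr (ρ T_t(x)) = tr (ρ x)`. -/
def UniformlyContinuousQMS.IsInvariant (S : UniformlyContinuousQMS H) (ρ : H →L[ℂ] H) : Prop :=
  ∀ t x, opTrace (ρ * S.T t x) = opTrace (ρ * x)

/-- `S'` is the `Θ`-KMS adjoint semigroup of `S` with respect to `ρ`. -/
def UniformlyContinuousQMS.IsThetaKMSAdjoint (θ : H ≃ₗᵢ⋆[ℂ] H) (ρ : H →L[ℂ] H)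
    (S S' : UniformlyContinuousQMS H) : Prop :=
  ∀ t, ChoiJamiolkowski.IsThetaKMSAdjoint θ ρ (S.T t) (S'.T t)

end Maps

/-! ### Choi–Jamiołkowski operators and the two-point states -/

section Choi
variable {H : Type*} [NormedAddCommGroup H] [InnerProductSpace ℂ H] [CompleteSpace H]
variable {ι : Type*}

/-- `J` is a bounded operator representing the sesquilinear form that defines
`J_ρ(Φ_*) = (1 ⊗ Φ_*)(ω_ρ)`, where `ω_ρ = ∑ₖₘ |eₖ⟩⟨eₘ| ⊗ |ρ^{1/2} eₖ⟩⟨ρ^{1/2} eₘ|`: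
`⟪eₖ ⊗ eₗ, J (eₘ ⊗ eₙ)⟫ = ⟪eₗ, Φ_*(|ρ^{1/2} eₖ⟩⟨ρ^{1/2} eₘ|) eₙ⟫`. There is at most one such `J`. -/
def IsChoiOperator (e : HilbertBasis ι ℂ H) (ρ : H →L[ℂ] H) (Φs : L1 H →ₗ[ℂ] L1 H)
    (J : HilbertTensor H →L[ℂ] HilbertTensor H) : Prop :=
  ∀ k l m n, ⟪tmul (e k) (e l), J (tmul (e m) (e n))⟫_ℂ =
    ⟪e l, (Φs (ketBra (CFC.sqrt ρ (e k)) (CFC.sqrt ρ (e m))) : H →L[ℂ] H) (e n)⟫_ℂ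

open Classical in
/-- The `ρ`-Choi–Jamiołkowski operator `J_ρ(Φ_*)` with respect to the orthonormal basis `e`
(and `0` if the form is unbounded, which does not happen for a bounded completely positive `Φ_*`
and a state `ρ`). -/
def choiOperator (e : HilbertBasis ι ℂ H) (ρ : H →L[ℂ] H) (Φs : L1 H →ₗ[ℂ] L1 H) :
    HilbertTensor H →L[ℂ] HilbertTensor H :=
  if h : ∃ J, IsChoiOperator e ρ Φs J then h.choose else 0

/-- The forward state `x ↦ tr (J_ρ(Φ_*) x)` on `B(H ⊗ H)`. -/
def forwardState (e : HilbertBasis ι ℂ H) (ρ : H →L[ℂ] H) (Φs : L1 H →ₗ[ℂ] L1 H)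
    (x : HilbertTensor H →L[ℂ] HilbertTensor H) : ℂ :=
  opTrace (choiOperator e ρ Φs * x)

/-- The backward state `x ↦ tr (J_ρ(Φ^Θ_*) x)` on `B(H ⊗ H)`, as a function of the predual
`ΦΘs = Φ^Θ_*` of the `Θ`-KMS adjoint `Φ^Θ`. -/
def backwardState (e : HilbertBasis ι ℂ H) (ρ : H →L[ℂ] H) (ΦΘs : L1 H →ₗ[ℂ] L1 H)
    (x : HilbertTensor H →L[ℂ] HilbertTensor H) : ℂ :=
  opTrace (choiOperator e ρ ΦΘs * x)

/-- The value `tr (ρ^{1/2} θ T_t(a^*) θ ρ^{1/2} b)` of the backward two-point state of the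
semigroup at the simple tensor `a ⊗ b`. -/
def backwardTwoPoint (θ : H ≃ₗᵢ⋆[ℂ] H) (ρ : H →L[ℂ] H) (S : UniformlyContinuousQMS H) (t : ℝ≥0)
    (a b : H →L[ℂ] H) : ℂ :=
  opTrace (CFC.sqrt ρ * sandwich θ (S.T t (star a)) * CFC.sqrt ρ * b)

/-- `D` is the density operator of the unique normal state on `B(H ⊗ H)` with the values `w a b`
at the simple tensors `a ⊗ b`. -/
def IsDensityOf (w : (H →L[ℂ] H) → (H →L[ℂ] H) → ℂ)
    (D : HilbertTensor H →L[ℂ] HilbertTensor H) : Prop :=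
  IsDensityOperator D ∧ (∀ a b, opTrace (D * opTensor a b) = w a b) ∧
    ∀ D', IsTraceClass D' → (∀ a b, opTrace (D' * opTensor a b) = w a b) → D' = D

end Choi

end ChoiJamiolkowski

end

open ChoiJamiolkowski

/-!
# Choi–Jamiołkowski operators and two-point states

Existence of the Choi operator. Complete positivity of `Φ_*` says that the operator-valued kernel
`(k, m) ↦ Φ_*(|ρ^{1/2} eₖ⟩⟨ρ^{1/2} eₘ|)` is positive semidefinite (`IsCPL1.posSemidef_kernel`), so
it equals `Wₖ^* Wₘ` for the kernel functions `Wₖ : H → F` of its reproducing kernel Hilbert space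
`F`. The vectors `Wₖ eₗ` are square summable, since
`∑ₗ ‖Wₖ eₗ‖² = tr Φ_*(|ρ^{1/2} eₖ⟩⟨ρ^{1/2} eₖ|) = ⟪eₖ, ρ^{1/2} Φ(1) ρ^{1/2} eₖ⟫` and
`ρ^{1/2} Φ(1) ρ^{1/2}` is trace class. Hence `eₖ ⊗ eₗ ↦ Wₖ eₗ` defines a Hilbert–Schmidt operator
`V` on `H ⊗ H`, and `V^* V` is the Choi operator, positive and trace class
(`exists_isChoiOperator`).

Values on simple tensors. The matrix entries of the Choi operator extend to
`⟪eₖ ⊗ eₗ, J (u ⊗ v)⟫ = ⟪eₗ, Φ_*(|ρ^{1/2} eₖ⟩⟨ρ^{1/2} θ u|) v⟫`, by continuity of the right-hand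
side, which duality expresses through `Φ`. Summing over the tensor basis with `u = a eₖ`,
`v = b eₗ` gives `tr (J (a ⊗ b))` (`opTrace_choiOperator_mul_opTensor`). Uniqueness follows on
taking `a` and `b` of rank one (`eq_of_opTrace_mul_opTensor`).

Semigroups. A positive operator matrix over `B(H)` pairs nonnegatively with a positive matrix over
`L₁(H)` (`sum_opTrace_mul_nonneg`), so the predual of a completely positive map is completely
positive. For the backward state, `Θ` is the transpose in the basis `e`: a trace preserving
anti-automorphism, which fixes `ρ^{1/2}` when `e` diagonalizes `ρ`. Applying `Θ` before and after
the KMS duality relation moves the semigroup from `b` to `a`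
(`IsThetaKMSAdjoint.opTrace_eq_backward`).

All of this rests on `tr (AB) = tr (BA)` for Hilbert–Schmidt `A` and `B`, computed in any
orthonormal basis (`hasSum_inner_mul_of_hs`).
-/

noncomputable section

namespace ChoiJamiolkowski

/-! ### Hilbert–Schmidt operators and the trace -/

section Trace
variable {E : Type*} [NormedAddCommGroup E] [InnerProductSpace ℂ E] [CompleteSpace E]
variable {ι κ : Type*}

/-- The Hilbert–Schmidt norm may be computed in any orthonormal basis. -/
lemma hs_eq_tsum (b : HilbertBasis ι ℂ E) (T : E →L[ℂ] E) : hs T = ∑' i, ‖T (b i)‖ₑ ^ 2 := by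
  rw [← hs_adjoint]
  have h1 : hs (ContinuousLinearMap.adjoint T) =
      ∑' j, ∑' i, ‖⟪b i, ContinuousLinearMap.adjoint T (stdHilbertBasis E j)⟫_ℂ‖ₑ ^ 2 :=
    tsum_congr fun j => enorm_sq_eq_tsum b _
  rw [h1, ENNReal.tsum_comm]
  refine tsum_congr fun i => ?_
  rw [enorm_sq_eq_tsum (stdHilbertBasis E)]
  refine tsum_congr fun j => ?_
  rw [ContinuousLinearMap.adjoint_inner_right, ← inner_conj_symm, RCLike.enorm_conj]

lemma hs_eq_tsum_prod (b : HilbertBasis ι ℂ E) (c : HilbertBasis κ ℂ E) (T : E →L[ℂ] E) :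
    hs T = ∑' p : ι × κ, ‖⟪b p.1, T (c p.2)⟫_ℂ‖ₑ ^ 2 := by
  rw [hs_eq_tsum c, ENNReal.tsum_prod', ENNReal.tsum_comm]
  exact tsum_congr fun j => enorm_sq_eq_tsum b _

lemma summable_inner_sq_of_hs {T : E →L[ℂ] E} (h : hs T ≠ ∞) (b : HilbertBasis ι ℂ E)
    (c : HilbertBasis κ ℂ E) : Summable fun p : ι × κ => ‖⟪b p.1, T (c p.2)⟫_ℂ‖ ^ 2 := by
  rw [hs_eq_tsum_prod b c] at h
  simpa only [ENNReal.toReal_pow, toReal_enorm] using ENNReal.summable_toReal h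

lemma hs_comp_right_ne_top {T : E →L[ℂ] E} (h : hs T ≠ ∞) (X : E →L[ℂ] E) : hs (T * X) ≠ ∞ := by
  rw [← hs_adjoint, ContinuousLinearMap.mul_def, ContinuousLinearMap.adjoint_comp]
  exact hs_comp_ne_top _ _ (by rwa [hs_adjoint])

lemma summable_inner_mul_inner_of_hs {A B : E →L[ℂ] E} (hA : hs A ≠ ∞) (hB : hs B ≠ ∞)
    (b : HilbertBasis ι ℂ E) (c : HilbertBasis κ ℂ E) :
    Summable fun p : ι × κ => ⟪b p.1, A (c p.2)⟫_ℂ * ⟪c p.2, B (b p.1)⟫_ℂ := by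
  have h1 := summable_inner_sq_of_hs hA b c
  have h2 := (Equiv.prodComm ι κ).summable_iff.2 (summable_inner_sq_of_hs hB c b)
  refine Summable.of_norm_bounded (h1.add h2) fun p => ?_
  simp only [Function.comp_apply, Equiv.prodComm_apply, Prod.fst_swap, Prod.snd_swap, norm_mul]
  nlinarith [sq_nonneg (‖⟪b p.1, A (c p.2)⟫_ℂ‖ - ‖⟪c p.2, B (b p.1)⟫_ℂ‖),
    sq_nonneg ‖⟪b p.1, A (c p.2)⟫_ℂ‖, sq_nonneg ‖⟪c p.2, B (b p.1)⟫_ℂ‖]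

lemma hasSum_inner_mul_of_hs_double {A B : E →L[ℂ] E} (hA : hs A ≠ ∞) (hB : hs B ≠ ∞)
    (b : HilbertBasis ι ℂ E) (c : HilbertBasis κ ℂ E) :
    HasSum (fun i => ⟪b i, (A * B) (b i)⟫_ℂ)
      (∑' p : ι × κ, ⟪b p.1, A (c p.2)⟫_ℂ * ⟪c p.2, B (b p.1)⟫_ℂ) := by
  refine (summable_inner_mul_inner_of_hs hA hB b c).hasSum.prod_fiberwise fun i => ?_
  have := c.hasSum_inner_mul_inner (ContinuousLinearMap.adjoint A (b i)) (B (b i))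
  simpa only [ContinuousLinearMap.adjoint_inner_left, ← mul_apply_eq_comp] using this

/-- For Hilbert–Schmidt `A` and `B`, the trace of `AB` in any basis is the trace of `BA` in the
fixed one: both are the sum of one absolutely convergent double series. -/
lemma hasSum_inner_mul_of_hs {A B : E →L[ℂ] E} (hA : hs A ≠ ∞) (hB : hs B ≠ ∞)
    (b : HilbertBasis ι ℂ E) :
    HasSum (fun i => ⟪b i, (A * B) (b i)⟫_ℂ) (opTrace (B * A)) := by
  have h := hasSum_inner_mul_of_hs_double hA hB b (stdHilbertBasis E)
  convert! h using 1
  rw [opTrace, (hasSum_inner_mul_of_hs_double hB hA (stdHilbertBasis E) b).tsum_eq,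
    ← (Equiv.prodComm ι _).tsum_eq]
  exact tsum_congr fun p => mul_comm _ _

lemma opTrace_mul_comm_of_hs {A B : E →L[ℂ] E} (hA : hs A ≠ ∞) (hB : hs B ≠ ∞) :
    opTrace (A * B) = opTrace (B * A) :=
  (hasSum_inner_mul_of_hs hA hB (stdHilbertBasis E)).tsum_eq

lemma isTraceClass_mul_of_hs {A B : E →L[ℂ] E} (hA : hs A ≠ ∞) (hB : hs B ≠ ∞) :
    IsTraceClass (A * B) :=
  isTraceClass_of_summable_mul fun X => by
    rw [← mul_assoc]
    exact (hasSum_inner_mul_of_hs (hs_comp_ne_top X A hA) hB _).summable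

lemma hs_sqrt_ne_top_iff {P : E →L[ℂ] E} (hP : 0 ≤ P) (b : HilbertBasis ι ℂ E) :
    hs (CFC.sqrt P) ≠ ∞ ↔ Summable fun i => ⟪b i, P (b i)⟫_ℂ := by
  simp_rw [inner_sqrt hP, Complex.summable_ofReal]
  rw [hs_eq_tsum b]
  constructor
  · intro h
    simpa using ENNReal.summable_toReal h
  · intro h
    convert h.tsum_ofReal_ne_top using 4 with i
    rw [← ofReal_norm, ENNReal.ofReal_pow (norm_nonneg _)]

lemma isTraceClass_of_nonneg {P : E →L[ℂ] E} (hP : 0 ≤ P) (b : HilbertBasis ι ℂ E)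
    (h : Summable fun i => ⟪b i, P (b i)⟫_ℂ) : IsTraceClass P := by
  rw [IsTraceClass, CFC.abs_of_nonneg P hP, ← hs_sqrt_ne_top_iff hP]
  exact (hs_sqrt_ne_top_iff hP b).2 h

lemma IsTraceClass.hs_sqrt_ne_top {P : E →L[ℂ] E} (h : IsTraceClass P) (hP : 0 ≤ P) :
    hs (CFC.sqrt P) ≠ ∞ := by
  rw [IsTraceClass, CFC.abs_of_nonneg P hP] at h
  exact (hs_sqrt_ne_top_iff hP _).2 h

/-- A trace class operator is a product of two Hilbert–Schmidt operators, by polar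
decomposition. -/
lemma IsTraceClass.exists_hs_mul_hs {A : E →L[ℂ] E} (h : IsTraceClass A) :
    ∃ P Q : E →L[ℂ] E, hs P ≠ ∞ ∧ hs Q ≠ ∞ ∧ A = P * Q := by
  obtain ⟨W, hW⟩ := exists_eq_abs A
  have hs' : hs (CFC.sqrt (CFC.abs A)) ≠ ∞ := (hs_sqrt_ne_top_iff (CFC.abs_nonneg A) _).2 h
  refine ⟨W * CFC.sqrt (CFC.abs A), CFC.sqrt (CFC.abs A), hs_comp_ne_top _ _ hs', hs', ?_⟩
  rw [mul_assoc, CFC.sqrt_mul_sqrt_self _ (CFC.abs_nonneg A), ← hW]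

lemma IsTraceClass.mul_right {A : E →L[ℂ] E} (h : IsTraceClass A) (X : E →L[ℂ] E) :
    IsTraceClass (A * X) := by
  obtain ⟨P, Q, hP, hQ, rfl⟩ := h.exists_hs_mul_hs
  rw [mul_assoc]
  exact isTraceClass_mul_of_hs hP (hs_comp_right_ne_top hQ X)

/-- The trace of a trace class operator may be computed in any orthonormal basis. -/
lemma IsTraceClass.hasSum_inner {A : E →L[ℂ] E} (h : IsTraceClass A) (b : HilbertBasis ι ℂ E) :
    HasSum (fun i => ⟪b i, A (b i)⟫_ℂ) (opTrace A) := by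
  obtain ⟨P, Q, hP, hQ, rfl⟩ := h.exists_hs_mul_hs
  rw [opTrace_mul_comm_of_hs hP hQ]
  exact hasSum_inner_mul_of_hs hP hQ b

lemma IsTraceClass.opTrace_mul_comm {A : E →L[ℂ] E} (h : IsTraceClass A) (X : E →L[ℂ] E) :
    opTrace (A * X) = opTrace (X * A) := by
  obtain ⟨P, Q, hP, hQ, rfl⟩ := h.exists_hs_mul_hs
  rw [mul_assoc, opTrace_mul_comm_of_hs hP (hs_comp_right_ne_top hQ X), mul_assoc,
    opTrace_mul_comm_of_hs hQ (hs_comp_ne_top X P hP), mul_assoc]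

lemma IsTraceClass.opTrace_add {A B : E →L[ℂ] E} (hA : IsTraceClass A) (hB : IsTraceClass B) :
    opTrace (A + B) = opTrace A + opTrace B := by
  have h := (hA.hasSum_inner (stdHilbertBasis E)).add (hB.hasSum_inner (stdHilbertBasis E))
  simp only [← inner_add_right] at h
  exact h.tsum_eq

lemma opTrace_rankOne (x y : E) : opTrace (InnerProductSpace.rankOne ℂ x y) = ⟪y, x⟫_ℂ := by
  have := (stdHilbertBasis E).hasSum_inner_mul_inner y x
  rw [opTrace, ← this.tsum_eq]
  simp

lemma opTrace_mul_rankOne (X : E →L[ℂ] E) (x y : E) :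
    opTrace (X * InnerProductSpace.rankOne ℂ x y) = ⟪y, X x⟫_ℂ := by
  rw [ContinuousLinearMap.mul_def, InnerProductSpace.comp_rankOne, opTrace_rankOne]

lemma opTrace_rankOne_mul (X : E →L[ℂ] E) (x y : E) :
    opTrace (InnerProductSpace.rankOne ℂ x y * X) = ⟪y, X x⟫_ℂ := by
  rw [(isTraceClass_rankOne x y).opTrace_mul_comm, opTrace_mul_rankOne]

end Trace

/-! ### Operators prescribed on an orthonormal basis -/

section Basis
variable {E F : Type*} [NormedAddCommGroup E] [InnerProductSpace ℂ E]
  [NormedAddCommGroup F] [InnerProductSpace ℂ F] {ι : Type*}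

lemma clm_ext_basis (b : HilbertBasis ι ℂ E) {S T : E →L[ℂ] F} (h : ∀ i, S (b i) = T (b i)) :
    S = T :=
  ContinuousLinearMap.ext_on
    (Submodule.dense_iff_topologicalClosure_eq_top.2 b.dense_span)
    (by rintro _ ⟨i, rfl⟩; exact h i)

/-- Square summable vectors are the images of an orthonormal basis under a bounded operator. -/
lemma exists_clm_apply_basis [CompleteSpace F] (b : HilbertBasis ι ℂ E) {v : ι → F}
    (hv : Summable fun i => ‖v i‖ ^ 2) : ∃ V : E →L[ℂ] F, ∀ i, V (b i) = v i := by
  have hx (x : E) : HasSum (fun i => ‖⟪b i, x⟫_ℂ‖ ^ 2) (‖x‖ ^ 2) := by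
    have h3 := Complex.hasSum_re (b.hasSum_inner_mul_inner x x)
    convert! h3 using 2 with i
    · rw [← inner_conj_symm x (b i), ← Complex.normSq_eq_conj_mul_self, Complex.ofReal_re,
        Complex.normSq_eq_norm_sq]
    · rw [inner_self_eq_norm_sq_to_K]; norm_cast
  -- Cauchy–Schwarz: `∑ᵢ |⟪bᵢ, x⟫| ‖vᵢ‖ ≤ ‖x‖ (∑ᵢ ‖vᵢ‖²)^{1/2}`
  have hCS (x : E) := Real.summable_and_inner_le_Lp_mul_Lq_tsum_of_nonneg
    (f := fun i => ‖⟪b i, x⟫_ℂ‖) (g := fun i => ‖v i‖) Real.HolderConjugate.two_two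
    (fun _ => norm_nonneg _) (fun _ => norm_nonneg _)
    (by simpa using (hx x).summable) (by simpa using hv)
  have hs (x : E) : Summable fun i => ⟪b i, x⟫_ℂ • v i :=
    Summable.of_norm (by simpa only [norm_smul] using (hCS x).1)
  let V : E →ₗ[ℂ] F :=
    { toFun := fun x => ∑' i, ⟪b i, x⟫_ℂ • v i
      map_add' := fun x y => by
        rw [← (hs x).tsum_add (hs y)]
        simp only [inner_add_right, add_smul]
      map_smul' := fun c x => by
        rw [RingHom.id_apply, ← (hs x).tsum_const_smul]
        simp only [inner_smul_right, mul_smul] }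
  refine ⟨V.mkContinuous ((∑' i, ‖v i‖ ^ (2 : ℝ)) ^ (1 / (2 : ℝ))) fun x => ?_, fun i => ?_⟩
  · refine (norm_tsum_le_tsum_norm (by simpa only [norm_smul] using (hCS x).1)).trans ?_
    simp only [norm_smul]
    refine (hCS x).2.trans (le_of_eq ?_)
    rw [mul_comm]
    congr 1
    simp only [Real.rpow_two]
    rw [(hx x).tsum_eq, ← Real.sqrt_eq_rpow, Real.sqrt_sq (norm_nonneg _)]
  · change ∑' j, ⟪b j, b i⟫_ℂ • v j = v i
    rw [tsum_eq_single i]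
    · simp [b.orthonormal.1 i, inner_self_eq_norm_sq_to_K]
    · intro j hj
      rw [b.orthonormal.2 hj, zero_smul]

end Basis

/-! ### The tensor product basis -/

section TensorBasis
variable {H : Type*} [NormedAddCommGroup H] [InnerProductSpace ℂ H] {ι : Type*}

/-- The map `v ↦ u ⊗ v`. -/
def tmulRight (u : H) : H →L[ℂ] HilbertTensor H :=
  (UniformSpace.Completion.toComplL : H ⊗[ℂ] H →L[ℂ] UniformSpace.Completion (H ⊗[ℂ] H)).comp
    (TensorProduct.mkL ℂ H H u)

/-- The map `u ↦ u ⊗ v`. -/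
def tmulLeft (v : H) : H →L[ℂ] HilbertTensor H :=
  (UniformSpace.Completion.toComplL : H ⊗[ℂ] H →L[ℂ] UniformSpace.Completion (H ⊗[ℂ] H)).comp
    ((TensorProduct.mkL ℂ H H).flip v)

lemma eq_zero_of_inner_tmul_basis (e : HilbertBasis ι ℂ H) {z : HilbertTensor H}
    (h : ∀ k l, ⟪z, tmul (e k) (e l)⟫_ℂ = 0) : z = 0 := by
  have h1 (k : ι) : (innerSL ℂ z).comp (tmulRight (e k)) = 0 :=
    clm_ext_basis e fun l => h k l
  have h2 (v : H) : (innerSL ℂ z).comp (tmulLeft v) = 0 :=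
    clm_ext_basis e fun k => DFunLike.congr_fun (h1 k) v
  have h3 : innerSL ℂ z = 0 := by
    refine ContinuousLinearMap.ext_on dense_span_tmul ?_
    rintro _ ⟨p, rfl⟩
    exact DFunLike.congr_fun (h2 p.2) p.1
  exact inner_self_eq_zero.1 (DFunLike.congr_fun h3 z)

lemma orthonormal_tmul (e : HilbertBasis ι ℂ H) :
    Orthonormal ℂ fun p : ι × ι => tmul (e p.1) (e p.2) := by
  classical
  have he := orthonormal_iff_ite.1 e.orthonormal
  rw [orthonormal_iff_ite]
  rintro ⟨k, l⟩ ⟨m, n⟩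
  simp only [inner_tmul, he, Prod.mk.injEq]
  split_ifs <;> simp_all

/-- The orthonormal basis `e_k ⊗ e_l` of `H ⊗ H`. -/
def tensorBasis (e : HilbertBasis ι ℂ H) : HilbertBasis (ι × ι) ℂ (HilbertTensor H) :=
  HilbertBasis.mkOfOrthogonalEqBot (orthonormal_tmul e) <| by
    rw [Submodule.eq_bot_iff]
    intro z hz
    refine eq_zero_of_inner_tmul_basis e fun k l => ?_
    exact (Submodule.mem_orthogonal' _ _).1 hz _ (Submodule.subset_span ⟨(k, l), rfl⟩)

lemma tensorBasis_apply (e : HilbertBasis ι ℂ H) (p : ι × ι) :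
    tensorBasis e p = tmul (e p.1) (e p.2) := by
  rw [tensorBasis, HilbertBasis.coe_mkOfOrthogonalEqBot]

lemma opTensor_one_one : opTensor (1 : H →L[ℂ] H) 1 = 1 := by
  refine ContinuousLinearMap.ext_on dense_span_tmul ?_
  rintro _ ⟨p, rfl⟩
  simp [opTensor_tmul]

lemma opTensor_rankOne (u v u' v' : H) :
    opTensor (InnerProductSpace.rankOne ℂ u v) (InnerProductSpace.rankOne ℂ u' v') =
      InnerProductSpace.rankOne ℂ (tmul u u') (tmul v v') := by
  refine ContinuousLinearMap.ext_on dense_span_tmul ?_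
  rintro _ ⟨p, rfl⟩
  have h1 (c : ℂ) (x y : H) : tmul (c • x) y = c • tmul x y := (tmulLeft y).map_smul c x
  have h2 (c : ℂ) (x y : H) : tmul x (c • y) = c • tmul x y := (tmulRight x).map_smul c y
  simp [opTensor_tmul, inner_tmul, h1, h2, smul_smul]

/-- A bounded operator on `H ⊗ H` is determined by its traces against the simple tensors `a ⊗ b`,
already for `a` and `b` of rank one. -/
lemma eq_of_opTrace_mul_opTensor (e : HilbertBasis ι ℂ H)
    {D D' : HilbertTensor H →L[ℂ] HilbertTensor H}
    (h : ∀ a b : H →L[ℂ] H, opTrace (D * opTensor a b) = opTrace (D' * opTensor a b)) :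
    D = D' := by
  refine clm_ext_basis (tensorBasis e) fun q => ?_
  rw [← sub_eq_zero]
  refine eq_zero_of_inner_tmul_basis e fun k l => ?_
  have := h (InnerProductSpace.rankOne ℂ (e q.1) (e k)) (InnerProductSpace.rankOne ℂ (e q.2) (e l))
  rw [opTensor_rankOne, opTrace_mul_rankOne, opTrace_mul_rankOne] at this
  rw [← inner_conj_symm, inner_sub_right, tensorBasis_apply, this, sub_self, map_zero]

end TensorBasis

/-! ### The conjugation -/

section Conj
variable {H : Type*} [NormedAddCommGroup H] [InnerProductSpace ℂ H] {ι : Type*}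

lemma basis_inner_conjugation (e : HilbertBasis ι ℂ H) (i : ι) (x : H) :
    ⟪e i, conjugation e x⟫_ℂ = ⟪x, e i⟫_ℂ := by
  rw [← inner_conj_symm x (e i), ← e.repr_apply_apply, ← e.repr_apply_apply]
  simp [conjugation]

lemma conjugation_inner_conjugation (e : HilbertBasis ι ℂ H) (x y : H) :
    ⟪conjugation e x, conjugation e y⟫_ℂ = ⟪y, x⟫_ℂ := by
  rw [← (e.hasSum_inner_mul_inner y x).tsum_eq,
    ← (e.hasSum_inner_mul_inner (conjugation e x) (conjugation e y)).tsum_eq]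
  refine tsum_congr fun i => ?_
  rw [basis_inner_conjugation, ← inner_conj_symm, basis_inner_conjugation, inner_conj_symm,
    mul_comm]

lemma conjugation_conjugation (e : HilbertBasis ι ℂ H) (x : H) :
    conjugation e (conjugation e x) = x := by
  simp [conjugation]

lemma conjugation_basis (e : HilbertBasis ι ℂ H) (i : ι) : conjugation e (e i) = e i := by
  classical
  refine e.repr.injective (lp.ext (funext fun j => ?_))
  rw [e.repr_apply_apply, e.repr_apply_apply, basis_inner_conjugation,
    orthonormal_iff_ite.1 e.orthonormal, orthonormal_iff_ite.1 e.orthonormal]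
  simp only [eq_comm]

/-- Antiunitarity of an involution in adjoint form. -/
lemma conjugation_inner_left (e : HilbertBasis ι ℂ H) (x y : H) :
    ⟪conjugation e x, y⟫_ℂ = ⟪conjugation e y, x⟫_ℂ := by
  have h := conjugation_inner_conjugation e x (conjugation e y)
  rwa [conjugation_conjugation] at h

lemma sandwich_apply (θ : H ≃ₗᵢ⋆[ℂ] H) (x : H →L[ℂ] H) (u : H) :
    sandwich θ x u = θ (x (θ u)) := rfl

lemma sandwich_conjugation_mul (e : HilbertBasis ι ℂ H) (x y : H →L[ℂ] H) :
    sandwich (conjugation e) (x * y) = sandwich (conjugation e) x * sandwich (conjugation e) y := by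
  ext u
  simp [sandwich_apply, conjugation_conjugation]

lemma sandwich_conjugation_one (e : HilbertBasis ι ℂ H) :
    sandwich (conjugation e) 1 = 1 := by
  ext u
  simp [sandwich_apply, conjugation_conjugation]

lemma sandwich_conjugation_sandwich (e : HilbertBasis ι ℂ H) (x : H →L[ℂ] H) :
    sandwich (conjugation e) (sandwich (conjugation e) x) = x := by
  ext u
  simp [sandwich_apply, conjugation_conjugation]

lemma adjoint_sandwich_conjugation [CompleteSpace H] (e : HilbertBasis ι ℂ H) (x : H →L[ℂ] H) :
    ContinuousLinearMap.adjoint (sandwich (conjugation e) x) =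
      sandwich (conjugation e) (ContinuousLinearMap.adjoint x) := by
  refine (ContinuousLinearMap.eq_adjoint_iff _ _).2 (fun u v => ?_) |>.symm
  have h := conjugation_inner_conjugation e (conjugation e (x (conjugation e v))) u
  rw [conjugation_conjugation] at h
  rw [sandwich_apply, sandwich_apply, conjugation_inner_left,
    ContinuousLinearMap.adjoint_inner_right, h]

end Conj

/-! ### Complete positivity -/

section CP
variable {H : Type*} [NormedAddCommGroup H] [InnerProductSpace ℂ H] [CompleteSpace H] {ι : Type*}

lemma sum_inner_ketBra_nonneg {n : ℕ} (r v : Fin n → H) :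
    0 ≤ ∑ i, ∑ j, ⟪v i, (ketBra (r i) (r j) : H →L[ℂ] H) (v j)⟫_ℂ := by
  have h : ∑ i, ∑ j, ⟪v i, (ketBra (r i) (r j) : H →L[ℂ] H) (v j)⟫_ℂ =
      star (∑ i, ⟪r i, v i⟫_ℂ) * ∑ j, ⟪r j, v j⟫_ℂ := by
    rw [star_sum, Finset.sum_mul_sum]
    refine Finset.sum_congr rfl fun i _ => Finset.sum_congr rfl fun j _ => ?_
    simp [ketBra, mul_comm]
  rw [h]
  exact star_mul_self_nonneg _

lemma IsCPL1.sum_ketBra_nonneg {Φs : L1 H →ₗ[ℂ] L1 H} (h : IsCPL1 Φs) (r : ι → H) (s : Finset ι)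
    (v : ι → H) :
    0 ≤ ∑ i ∈ s, ∑ j ∈ s, ⟪v i, (Φs (ketBra (r i) (r j)) : H →L[ℂ] H) (v j)⟫_ℂ := by
  have := h s.card (fun i j => ketBra (r (s.equivFin.symm i)) (r (s.equivFin.symm j)))
    (sum_inner_ketBra_nonneg _) fun i => v (s.equivFin.symm i)
  rw [← Finset.sum_coe_sort s, ← s.equivFin.symm.sum_comp]
  simpa only [← Finset.sum_coe_sort s, ← s.equivFin.symm.sum_comp] using this

/-- A completely positive map preserves adjoints: polarize the positivity of the image of the
`2 × 2` operator matrix with entries `|xᵢ⟩⟨xⱼ|`. -/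
lemma IsCPL1.inner_ketBra_symm {Φs : L1 H →ₗ[ℂ] L1 H} (h : IsCPL1 Φs) (x y u v : H) :
    ⟪(Φs (ketBra x y) : H →L[ℂ] H) u, v⟫_ℂ = ⟪u, (Φs (ketBra y x) : H →L[ℂ] H) v⟫_ℂ := by
  have key (c d : ℂ) := (h 2 (fun i j => ketBra (![x, y] i) (![x, y] j))
    (sum_inner_ketBra_nonneg _) ![c • v, d • u])
  simp only [Fin.sum_univ_two, Matrix.cons_val_zero, Matrix.cons_val_one, map_smul,
    inner_smul_left, inner_smul_right, Complex.le_def, Complex.zero_im, Complex.zero_re] at key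
  -- the values at `(1, 0)`, `(0, 1)`, `(1, 1)` and `(I, 1)` are real
  have h1 := (key 1 0).2
  have h2 := (key 0 1).2
  have h3 := (key 1 1).2
  have h4 := (key Complex.I 1).2
  have hA := inner_conj_symm (𝕜 := ℂ) ((Φs (ketBra x y) : H →L[ℂ] H) u) v
  generalize ⟪v, (Φs (ketBra x y) : H →L[ℂ] H) u⟫_ℂ = A at h1 h2 h3 h4 hA
  rw [← hA]
  apply Complex.ext <;> simp at h1 h2 h3 h4 ⊢ <;> linarith

/-- The Choi kernel `(k, m) ↦ Φ_*(|rₖ⟩⟨rₘ|)` of a completely positive map is an operator-valued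
positive semidefinite kernel. -/
lemma IsCPL1.posSemidef_kernel {Φs : L1 H →ₗ[ℂ] L1 H} (h : IsCPL1 Φs) (r : ι → H) :
    (Matrix.of fun k m : ι => (Φs (ketBra (r k) (r m)) : H →L[ℂ] H)).PosSemidef := by
  have h2 := (RKHS.posSemidef_tfae (K := Matrix.of fun k m : ι =>
    (Φs (ketBra (r k) (r m)) : H →L[ℂ] H))).out 0 2
  refine h2.2 ⟨?_, fun f => ?_⟩
  · ext k m u
    refine ext_inner_right ℂ fun v => ?_
    rw [Matrix.conjTranspose_apply, ContinuousLinearMap.star_eq_adjoint,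
      ContinuousLinearMap.adjoint_inner_left]
    exact (h.inner_ketBra_symm _ _ _ _).symm
  · have := (Complex.le_def.1 (h.sum_ketBra_nonneg r f.support f)).1
    refine this.trans_eq ?_
    simp only [Finsupp.sum, Matrix.of_apply, h.inner_ketBra_symm]
    rfl

lemma nonneg_cstarMatrix_rankOne {n : ℕ} (v : Fin n → H) :
    (0 : CStarMatrix (Fin n) (Fin n) (H →L[ℂ] H)) ≤
      CStarMatrix.ofMatrix (Matrix.of fun j i => InnerProductSpace.rankOne ℂ (v j) (v i)) := by
  set M : CStarMatrix (Fin n) (Fin n) (H →L[ℂ] H) :=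
    CStarMatrix.ofMatrix (Matrix.of fun j i => InnerProductSpace.rankOne ℂ (v j) (v i))
  have hM (j i) : M j i = InnerProductSpace.rankOne ℂ (v j) (v i) := rfl
  set c : ℝ := ∑ k, ‖v k‖ ^ 2
  by_cases hc : c = 0
  · have hv (k) : v k = 0 := by
      have := (Finset.sum_eq_zero_iff_of_nonneg fun k _ => sq_nonneg ‖v k‖).1 hc k
        (Finset.mem_univ k)
      simpa using this
    have : M = 0 := by
      ext j i : 2
      rw [hM, hv]
      simp
    rw [this]
  · have hpos : 0 < c := lt_of_le_of_ne (Finset.sum_nonneg fun k _ => sq_nonneg _) (Ne.symm hc)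
    -- `M² = (∑ₖ ‖vₖ‖²) M`, so `M` is a square up to a positive factor
    have : M = star (((√c)⁻¹ : ℂ) • M) * (((√c)⁻¹ : ℂ) • M) := by
      ext j i x
      have hcc : ((√c : ℝ) : ℂ)⁻¹ * ((√c : ℝ) : ℂ)⁻¹ * (c : ℂ) = 1 := by
        rw [← Complex.ofReal_inv, ← Complex.ofReal_mul, ← mul_inv, Real.mul_self_sqrt hpos.le,
          ← Complex.ofReal_mul, inv_mul_cancel₀ hc, Complex.ofReal_one]
      have hsum : ∑ k, ⟪v k, v k⟫_ℂ = (c : ℂ) := by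
        simp [c, inner_self_eq_norm_sq_to_K]
      simp only [CStarMatrix.mul_apply, CStarMatrix.star_apply, CStarMatrix.smul_apply, hM,
        ContinuousLinearMap.star_eq_adjoint, map_smulₛₗ, sum_apply,
        mul_apply_eq_comp, InnerProductSpace.adjoint_rankOne]
      have hterm (k : Fin n) : ((starRingEnd ℂ) ((√c : ℝ) : ℂ)⁻¹ •
          InnerProductSpace.rankOne ℂ (v j) (v k))
            ((((√c : ℝ) : ℂ)⁻¹ • InnerProductSpace.rankOne ℂ (v k) (v i)) x) =
          (((√c : ℝ) : ℂ)⁻¹ * ((√c : ℝ) : ℂ)⁻¹ * ⟪v k, v k⟫_ℂ * ⟪v i, x⟫_ℂ) • v j := by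
        simp only [map_inv₀, Complex.conj_ofReal, smul_apply, InnerProductSpace.rankOne_apply,
          inner_smul_right, smul_smul]
        congr 1
        ring
      rw [Finset.sum_congr rfl fun k _ => hterm k, ← Finset.sum_smul, ← Finset.sum_mul,
        ← Finset.mul_sum, hsum, hcc, one_mul, InnerProductSpace.rankOne_apply]
    rw [this]
    exact star_mul_self_nonneg _

/-- A positive matrix of trace class operators pairs nonnegatively with a positive matrix of
bounded operators. It suffices to consider `N^* N`, where the pairing is
`∑ₖ tr (∑ᵢⱼ Nₖᵢ Xᵢⱼ Nₖⱼ^*)`. -/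
lemma sum_opTrace_mul_nonneg {n : ℕ} (X : Fin n → Fin n → L1 H)
    (hX : ∀ v : Fin n → H, 0 ≤ ∑ i, ∑ j, ⟪v i, (X i j : H →L[ℂ] H) (v j)⟫_ℂ)
    (P : CStarMatrix (Fin n) (Fin n) (H →L[ℂ] H)) (hP : 0 ≤ P) :
    0 ≤ ∑ i, ∑ j, opTrace ((X i j : H →L[ℂ] H) * P j i) := by
  rw [StarOrderedRing.nonneg_iff] at hP
  induction hP using AddSubmonoid.closure_induction with
  | zero => simp [opTrace]
  | add P Q _ _ hP hQ =>
    refine (add_nonneg hP hQ).trans_eq ?_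
    simp only [← Finset.sum_add_distrib]
    refine Finset.sum_congr rfl fun i _ => Finset.sum_congr rfl fun j _ => ?_
    rw [← IsTraceClass.opTrace_add (IsTraceClass.mul_right (X i j).2 _)
      (IsTraceClass.mul_right (X i j).2 _), ← mul_add]
    rfl
  | mem P hP =>
  obtain ⟨N, rfl⟩ := hP
  have h1 (i j k) : HasSum (fun b => ⟪ContinuousLinearMap.adjoint (N k i) (stdHilbertBasis H b),
      (X i j : H →L[ℂ] H) (ContinuousLinearMap.adjoint (N k j) (stdHilbertBasis H b))⟫_ℂ)
      (opTrace ((X i j : H →L[ℂ] H) * (star (N k j) * N k i))) := by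
    have hX' : IsTraceClass (X i j : H →L[ℂ] H) := (X i j).2
    have h := ((hX'.mul_right (star (N k j))).mul_left (N k i)).hasSum_inner (stdHilbertBasis H)
    rw [← mul_assoc, (hX'.mul_right (star (N k j))).opTrace_mul_comm]
    simpa only [ContinuousLinearMap.adjoint_inner_left, mul_apply_eq_comp,
      ContinuousLinearMap.star_eq_adjoint] using h
  have h2 (i j) : HasSum (fun b => ∑ k, ⟪ContinuousLinearMap.adjoint (N k i) (stdHilbertBasis H b),
      (X i j : H →L[ℂ] H) (ContinuousLinearMap.adjoint (N k j) (stdHilbertBasis H b))⟫_ℂ)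
      (opTrace ((X i j : H →L[ℂ] H) * (star N * N) j i)) := by
    have h := hasSum_sum (s := Finset.univ) fun k _ => h1 i j k
    convert! h using 1
    have hN : (star N * N) j i = ∑ k, star (N k j) * N k i := by
      rw [CStarMatrix.mul_apply]
      rfl
    rw [hN, Finset.mul_sum]
    induction (Finset.univ : Finset (Fin n)) using Finset.induction_on with
    | empty => simp [opTrace]
    | insert a s ha ih =>
      rw [Finset.sum_insert ha, Finset.sum_insert ha, ← ih, IsTraceClass.opTrace_add
        (IsTraceClass.mul_right (X i j).2 _)]
      rw [← Finset.mul_sum]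
      exact IsTraceClass.mul_right (X i j).2 _
  have h3 := hasSum_sum (s := Finset.univ) fun i _ =>
    hasSum_sum (s := Finset.univ) fun j _ => h2 i j
  refine h3.nonneg fun b => ?_
  have : ∑ i, ∑ j, ∑ k, ⟪ContinuousLinearMap.adjoint (N k i) (stdHilbertBasis H b),
      (X i j : H →L[ℂ] H) (ContinuousLinearMap.adjoint (N k j) (stdHilbertBasis H b))⟫_ℂ =
      ∑ k, ∑ i, ∑ j, ⟪ContinuousLinearMap.adjoint (N k i) (stdHilbertBasis H b),
      (X i j : H →L[ℂ] H) (ContinuousLinearMap.adjoint (N k j) (stdHilbertBasis H b))⟫_ℂ := by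
    exact (Finset.sum_congr rfl fun i _ => Finset.sum_comm).trans Finset.sum_comm
  rw [this]
  exact Finset.sum_nonneg fun k _ => hX _

/-- The predual of a completely positive map on `B(H)` is completely positive. -/
lemma isCPL1_of_isPredual {Φs : L1 H →ₗ[ℂ] L1 H} {Φ : (H →L[ℂ] H) →L[ℂ] (H →L[ℂ] H)}
    (h : IsPredual Φs Φ) (φ : CompletelyPositiveMap (H →L[ℂ] H) (H →L[ℂ] H))
    (hφ : ∀ x, φ x = Φ x) : IsCPL1 Φs := by
  intro n X hX v
  have := sum_opTrace_mul_nonneg X hX _ (φ.map_cstarMatrix_nonneg _ (nonneg_cstarMatrix_rankOne v))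
  convert! this using 6 with i _ j _
  rw [← opTrace_mul_rankOne, h, CStarMatrix.map_apply, hφ]
  rfl

end CP

/-! ### The Choi–Jamiołkowski operator -/

section ChoiOperator
variable {H : Type*} [NormedAddCommGroup H] [InnerProductSpace ℂ H] [CompleteSpace H] {ι : Type*}

lemma IsDensityOperator.hs_sqrt_ne_top {ρ : H →L[ℂ] H} (hρ : IsDensityOperator ρ) :
    hs (CFC.sqrt ρ) ≠ ∞ :=
  hρ.traceClass.hs_sqrt_ne_top hρ.nonneg

lemma adjoint_sqrt (P : H →L[ℂ] H) : ContinuousLinearMap.adjoint (CFC.sqrt P) = CFC.sqrt P :=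
  IsSelfAdjoint.of_nonneg (CFC.sqrt_nonneg P)

lemma sqrt_inner_left (P : H →L[ℂ] H) (x y : H) : ⟪CFC.sqrt P x, y⟫_ℂ = ⟪x, CFC.sqrt P y⟫_ℂ := by
  conv_rhs => rw [← adjoint_sqrt, ContinuousLinearMap.adjoint_inner_right]

lemma opTrace_sqrt_mul_mul_sqrt_mul {ρ : H →L[ℂ] H} (hρ : IsDensityOperator ρ)
    (x y : H →L[ℂ] H) :
    opTrace (CFC.sqrt ρ * x * CFC.sqrt ρ * y) = opTrace (x * (CFC.sqrt ρ * y * CFC.sqrt ρ)) := by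
  have h := hρ.hs_sqrt_ne_top
  rw [mul_assoc, mul_assoc, opTrace_mul_comm_of_hs h
    (hs_comp_ne_top _ _ (hs_comp_right_ne_top h y)), mul_assoc]

lemma isTraceClass_sqrt_mul_mul_sqrt {ρ : H →L[ℂ] H} (hρ : IsDensityOperator ρ) (y : H →L[ℂ] H) :
    IsTraceClass (CFC.sqrt ρ * y * CFC.sqrt ρ) :=
  isTraceClass_mul_of_hs (hs_comp_right_ne_top hρ.hs_sqrt_ne_top y) hρ.hs_sqrt_ne_top

lemma IsPredual.opTrace_ketBra_mul {Φs : L1 H →ₗ[ℂ] L1 H}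
    {Φ : (H →L[ℂ] H) →L[ℂ] (H →L[ℂ] H)} (h : IsPredual Φs Φ) (x y : H) (b : H →L[ℂ] H) :
    opTrace ((Φs (ketBra x y) : H →L[ℂ] H) * b) = ⟪y, Φ b x⟫_ℂ := by
  rw [h]
  exact opTrace_rankOne_mul _ _ _

/-- The Choi operator is `V^* V` for a Hilbert–Schmidt `V : H ⊗ H → F` with
`V (eₖ ⊗ eₗ) = Wₖ eₗ`, where `Wₖ : H → F` are the kernel functions of the reproducing kernel
Hilbert space `F` of `(k, m) ↦ Φ_*(|ρ^{1/2} eₖ⟩⟨ρ^{1/2} eₘ|)`, i.e. `Wₖ^* Wₘ` is this kernel. -/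
lemma exists_isChoiOperator (e : HilbertBasis ι ℂ H) {ρ : H →L[ℂ] H} (hρ : IsDensityOperator ρ)
    {Φs : L1 H →ₗ[ℂ] L1 H} {Φ : (H →L[ℂ] H) →L[ℂ] (H →L[ℂ] H)} (hcp : IsCPL1 Φs)
    (hd : IsPredual Φs Φ) :
    ∃ J, IsChoiOperator e ρ Φs J ∧ 0 ≤ J ∧ IsTraceClass J := by
  let K : Matrix ι ι (H →L[ℂ] H) :=
    Matrix.of fun k m => (Φs (ketBra (CFC.sqrt ρ (e k)) (CFC.sqrt ρ (e m))) : H →L[ℂ] H)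
  have : Fact K.PosSemidef := ⟨hcp.posSemidef_kernel _⟩
  let W (k : ι) : H →L[ℂ] RKHS.OfKernel K := RKHS.kerFun (RKHS.OfKernel K) k
  have hW (k m : ι) (u v : H) : ⟪W k u, W m v⟫_ℂ = ⟪u, K k m v⟫_ℂ := by
    have h := RKHS.kernel_inner (RKHS.OfKernel K) k m v u
    rw [RKHS.OfKernel.kernel_ofKernel] at h
    rw [← inner_conj_symm, ← h, inner_conj_symm]
  have hnorm (k l : ι) : ((‖W k (e l)‖ ^ 2 : ℝ) : ℂ) = ⟪e l, K k k (e l)⟫_ℂ := by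
    rw [← hW, inner_self_eq_norm_sq_to_K]; norm_cast
  have hl (k : ι) : HasSum (fun l => ((‖W k (e l)‖ ^ 2 : ℝ) : ℂ))
      ⟪e k, (CFC.sqrt ρ * Φ 1 * CFC.sqrt ρ) (e k)⟫_ℂ := by
    have h1 : IsTraceClass (K k k) := (Φs _).2
    have h := hd.opTrace_ketBra_mul (CFC.sqrt ρ (e k)) (CFC.sqrt ρ (e k)) 1
    rw [mul_one, sqrt_inner_left] at h
    simp only [hnorm, mul_apply_eq_comp, ← h]
    exact h1.hasSum_inner e
  have hsum : Summable fun p : ι × ι => ‖W p.1 (e p.2)‖ ^ 2 := by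
    rw [summable_prod_of_nonneg fun _ => sq_nonneg _]
    refine ⟨fun k => Complex.summable_ofReal.1 (hl k).summable, Complex.summable_ofReal.1 ?_⟩
    simp only [Complex.ofReal_tsum, (hl _).tsum_eq]
    exact ((isTraceClass_sqrt_mul_mul_sqrt hρ (Φ 1)).hasSum_inner e).summable
  obtain ⟨V, hV⟩ := exists_clm_apply_basis (tensorBasis e) hsum
  have hV' (k l : ι) : V (tmul (e k) (e l)) = W k (e l) := by
    rw [← hV (k, l), tensorBasis_apply]
  have hJ : (0 : HilbertTensor H →L[ℂ] HilbertTensor H) ≤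
      (ContinuousLinearMap.adjoint V).comp V := by
    rw [ContinuousLinearMap.nonneg_iff_isPositive]
    exact ContinuousLinearMap.isPositive_adjoint_comp_self V
  refine ⟨(ContinuousLinearMap.adjoint V).comp V, fun k l m n => ?_, hJ,
    isTraceClass_of_nonneg hJ (tensorBasis e) ?_⟩
  · rw [ContinuousLinearMap.comp_apply, ContinuousLinearMap.adjoint_inner_right, hV', hV', hW]
    rfl
  · simp only [ContinuousLinearMap.comp_apply, ContinuousLinearMap.adjoint_inner_right, hV,
      inner_self_eq_norm_sq_to_K]
    exact_mod_cast hsum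

lemma IsChoiOperator.unique {e : HilbertBasis ι ℂ H} {ρ : H →L[ℂ] H} {Φs : L1 H →ₗ[ℂ] L1 H}
    {J J' : HilbertTensor H →L[ℂ] HilbertTensor H} (h : IsChoiOperator e ρ Φs J)
    (h' : IsChoiOperator e ρ Φs J') : J = J' := by
  refine clm_ext_basis (tensorBasis e) fun q => ?_
  rw [← sub_eq_zero]
  refine eq_zero_of_inner_tmul_basis e fun k l => ?_
  rw [← inner_conj_symm, inner_sub_right, tensorBasis_apply, h, h', sub_self, map_zero]

lemma choiOperator_spec (e : HilbertBasis ι ℂ H) {ρ : H →L[ℂ] H} (hρ : IsDensityOperator ρ)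
    {Φs : L1 H →ₗ[ℂ] L1 H} {Φ : (H →L[ℂ] H) →L[ℂ] (H →L[ℂ] H)} (hcp : IsCPL1 Φs)
    (hd : IsPredual Φs Φ) :
    IsChoiOperator e ρ Φs (choiOperator e ρ Φs) ∧ 0 ≤ choiOperator e ρ Φs ∧
      IsTraceClass (choiOperator e ρ Φs) := by
  obtain ⟨J, hJ, hpos, htc⟩ := exists_isChoiOperator e hρ hcp hd
  have hex : ∃ J, IsChoiOperator e ρ Φs J := ⟨J, hJ⟩
  have h : IsChoiOperator e ρ Φs (choiOperator e ρ Φs) := by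
    rw [choiOperator, dif_pos hex]
    exact hex.choose_spec
  rw [h.unique hJ]
  exact ⟨hJ, hpos, htc⟩

/-- The defining relation of the Choi operator extends from basis vectors to `u ⊗ v`; the bra
`⟨ρ^{1/2} eₘ|` becomes `⟨ρ^{1/2} θ u|` because bras are antilinear. -/
lemma IsChoiOperator.inner_tmul {e : HilbertBasis ι ℂ H} {ρ : H →L[ℂ] H} {Φs : L1 H →ₗ[ℂ] L1 H}
    {Φ : (H →L[ℂ] H) →L[ℂ] (H →L[ℂ] H)} {J : HilbertTensor H →L[ℂ] HilbertTensor H}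
    (h : IsChoiOperator e ρ Φs J) (hd : IsPredual Φs Φ) (k l : ι) (u v : H) :
    ⟪tmul (e k) (e l), J (tmul u v)⟫_ℂ =
      ⟪e l, (Φs (ketBra (CFC.sqrt ρ (e k)) (CFC.sqrt ρ (conjugation e u))) : H →L[ℂ] H) v⟫_ℂ := by
  have h1 (m : ι) (v : H) : ⟪tmul (e k) (e l), J (tmul (e m) v)⟫_ℂ =
      ⟪e l, (Φs (ketBra (CFC.sqrt ρ (e k)) (CFC.sqrt ρ (e m))) : H →L[ℂ] H) v⟫_ℂ := by
    have : (innerSL ℂ (tmul (e k) (e l))).comp (J.comp (tmulRight (e m))) =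
        (innerSL ℂ (e l)).comp
          (Φs (ketBra (CFC.sqrt ρ (e k)) (CFC.sqrt ρ (e m))) : H →L[ℂ] H) :=
      clm_ext_basis e fun n => h k l m n
    exact DFunLike.congr_fun this v
  have h2 (x : H) : ⟪e l, (Φs (ketBra (CFC.sqrt ρ (e k)) (CFC.sqrt ρ x)) : H →L[ℂ] H) v⟫_ℂ =
      ⟪x, CFC.sqrt ρ (Φ (InnerProductSpace.rankOne ℂ v (e l)) (CFC.sqrt ρ (e k)))⟫_ℂ := by
    rw [← opTrace_mul_rankOne, hd.opTrace_ketBra_mul, sqrt_inner_left]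
  have h3 : (innerSL ℂ (tmul (e k) (e l))).comp (J.comp (tmulLeft v)) =
      innerSL ℂ (conjugation e
        (CFC.sqrt ρ (Φ (InnerProductSpace.rankOne ℂ v (e l)) (CFC.sqrt ρ (e k))))) := by
    refine clm_ext_basis e fun m => ?_
    refine (h1 m v).trans ?_
    rw [h2, innerSL_apply_apply, conjugation_inner_left, conjugation_basis]
  refine (DFunLike.congr_fun h3 u).trans ?_
  rw [h2, innerSL_apply_apply, conjugation_inner_left]

/-- The traces of the Choi operator against simple tensors. Summing
`⟪eₖ ⊗ eₗ, J (a eₖ ⊗ b eₗ)⟫` over `l` gives `tr (Φ_*(|ρ^{1/2} eₖ⟩⟨ρ^{1/2} θ a eₖ|) b)`, and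
`θ a eₖ = θ a θ eₖ`. -/
lemma opTrace_choiOperator_mul_opTensor (e : HilbertBasis ι ℂ H) {ρ : H →L[ℂ] H}
    (hρ : IsDensityOperator ρ) {Φs : L1 H →ₗ[ℂ] L1 H} {Φ : (H →L[ℂ] H) →L[ℂ] (H →L[ℂ] H)}
    (hcp : IsCPL1 Φs) (hd : IsPredual Φs Φ) (a b : H →L[ℂ] H) :
    opTrace (choiOperator e ρ Φs * opTensor a b) =
      opTrace (CFC.sqrt ρ * sandwich (conjugation e) (star a) * CFC.sqrt ρ * Φ b) := by
  obtain ⟨hJ, -, htc⟩ := choiOperator_spec e hρ hcp hd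
  have h1 := (htc.mul_right (opTensor a b)).hasSum_inner (tensorBasis e)
  simp only [tensorBasis_apply, mul_apply_eq_comp, opTensor_tmul, hJ.inner_tmul hd] at h1
  have h2 (k : ι) : HasSum (fun l => ⟪e l, (Φs (ketBra (CFC.sqrt ρ (e k))
      (CFC.sqrt ρ (conjugation e (a (e k))))) : H →L[ℂ] H) (b (e l))⟫_ℂ)
      ⟪e k, (sandwich (conjugation e) (star a) * (CFC.sqrt ρ * Φ b * CFC.sqrt ρ)) (e k)⟫_ℂ := by
    have htc' : IsTraceClass (Φs (ketBra (CFC.sqrt ρ (e k))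
      (CFC.sqrt ρ (conjugation e (a (e k))))) : H →L[ℂ] H) := (Φs _).2
    have h := (htc'.mul_right b).hasSum_inner e
    rw [hd.opTrace_ketBra_mul, sqrt_inner_left] at h
    have ha : conjugation e (a (e k)) =
        ContinuousLinearMap.adjoint (sandwich (conjugation e) (star a)) (e k) := by
      rw [adjoint_sandwich_conjugation, ContinuousLinearMap.star_eq_adjoint,
        ContinuousLinearMap.adjoint_adjoint, sandwich_apply, conjugation_basis]
    rw [ha, ContinuousLinearMap.adjoint_inner_left] at h
    rw [ha]
    exact h
  rw [opTrace_sqrt_mul_mul_sqrt_mul hρ]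
  exact (h1.prod_fiberwise h2).unique
    (((isTraceClass_sqrt_mul_mul_sqrt hρ (Φ b)).mul_left _).hasSum_inner e)

/-- The Choi operator of the predual of a unital map is a density operator, determined by its
traces against simple tensors. -/
lemma isDensityOf_choiOperator (e : HilbertBasis ι ℂ H) {ρ : H →L[ℂ] H}
    (hρ : IsDensityOperator ρ) {Φs : L1 H →ₗ[ℂ] L1 H} {Φ : (H →L[ℂ] H) →L[ℂ] (H →L[ℂ] H)}
    (hcp : IsCPL1 Φs) (hd : IsPredual Φs Φ) (h1 : Φ 1 = 1) :
    IsDensityOf (fun a b => opTrace (CFC.sqrt ρ * sandwich (conjugation e) (star a) *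
      CFC.sqrt ρ * Φ b)) (choiOperator e ρ Φs) := by
  obtain ⟨-, hpos, htc⟩ := choiOperator_spec e hρ hcp hd
  have htr := opTrace_choiOperator_mul_opTensor e hρ hcp hd
  refine ⟨⟨hpos, htc, ?_⟩, htr, fun D' _ hD' => ?_⟩
  · have h := htr 1 1
    rwa [opTensor_one_one, mul_one, h1, star_one, sandwich_conjugation_one, mul_one, mul_one,
      CFC.sqrt_mul_sqrt_self ρ hρ.nonneg, hρ.trace_eq_one] at h
  · exact eq_of_opTrace_mul_opTensor e fun a b => (hD' a b).trans (htr a b).symm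

end ChoiOperator

/-! ### The backward two-point state -/

section Backward
variable {H : Type*} [NormedAddCommGroup H] [InnerProductSpace ℂ H] [CompleteSpace H] {ι : Type*}

lemma reversing_mul (e : HilbertBasis ι ℂ H) (x y : H →L[ℂ] H) :
    reversing (conjugation e) (x * y) =
      reversing (conjugation e) y * reversing (conjugation e) x := by
  rw [reversing, star_mul, sandwich_conjugation_mul]; rfl

lemma reversing_reversing (e : HilbertBasis ι ℂ H) (x : H →L[ℂ] H) :
    reversing (conjugation e) (reversing (conjugation e) x) = x := by
  rw [reversing, reversing, ContinuousLinearMap.star_eq_adjoint, adjoint_sandwich_conjugation,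
    sandwich_conjugation_sandwich, ContinuousLinearMap.star_eq_adjoint,
    ContinuousLinearMap.adjoint_adjoint]

/-- `Θ` is the transpose in the basis `e`, so it preserves the diagonal. -/
lemma opTrace_reversing (e : HilbertBasis ι ℂ H) {A : H →L[ℂ] H} (hA : IsTraceClass A)
    (hA' : IsTraceClass (reversing (conjugation e) A)) :
    opTrace (reversing (conjugation e) A) = opTrace A := by
  refine (hA'.hasSum_inner e).unique ?_
  convert! hA.hasSum_inner e using 2 with i
  rw [reversing, sandwich_apply, conjugation_basis, basis_inner_conjugation,
    ContinuousLinearMap.star_eq_adjoint, ContinuousLinearMap.adjoint_inner_left]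

lemma reversing_of_apply_basis (e : HilbertBasis ι ℂ H) {A : H →L[ℂ] H}
    (h : ∀ i, ∃ r : ℂ, A (e i) = r • e i) : reversing (conjugation e) A = A := by
  classical
  choose r hr using h
  refine clm_ext_basis e fun i => e.repr.injective (lp.ext (funext fun j => ?_))
  rw [e.repr_apply_apply, e.repr_apply_apply, reversing, sandwich_apply, conjugation_basis,
    basis_inner_conjugation, ContinuousLinearMap.star_eq_adjoint,
    ContinuousLinearMap.adjoint_inner_left, hr, hr, inner_smul_right, inner_smul_right,
    orthonormal_iff_ite.1 e.orthonormal, orthonormal_iff_ite.1 e.orthonormal]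
  by_cases hij : i = j
  · simp [hij]
  · simp [hij, Ne.symm hij]

/-- An eigenvector of `P ≥ 0` is an eigenvector of `P^{1/2}`. -/
lemma sqrt_apply_of_eigenvector {P : H →L[ℂ] H} (hP : 0 ≤ P) {x : H} {r : ℝ} (hx : ‖x‖ = 1)
    (h : P x = (r : ℂ) • x) : CFC.sqrt P x = ((√r : ℝ) : ℂ) • x := by
  have hr : r = ‖CFC.sqrt P x‖ ^ 2 := by
    have h1 := inner_sqrt hP x
    rw [h, inner_smul_right, inner_self_eq_norm_sq_to_K, hx] at h1
    exact_mod_cast (by simpa using h1 : (r : ℂ) = ((‖CFC.sqrt P x‖ ^ 2 : ℝ) : ℂ))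
  rcases (Real.sqrt_nonneg r).eq_or_lt with hs | hs
  · have h0 : CFC.sqrt P x = 0 := by
      rw [hr, Real.sqrt_sq (norm_nonneg _)] at hs
      exact norm_eq_zero.1 hs.symm
    rw [← hs, h0, Complex.ofReal_zero, zero_smul]
  · -- `y = P^{1/2} x - √r x` satisfies `P^{1/2} y = -√r y`, so it vanishes as `P^{1/2} ≥ 0`
    set y := CFC.sqrt P x - ((√r : ℝ) : ℂ) • x with hy
    have hrr : ((√r : ℝ) : ℂ) * ((√r : ℝ) : ℂ) = r := by
      rw [← Complex.ofReal_mul, Real.mul_self_sqrt (hr ▸ sq_nonneg _)]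
    have hQ : CFC.sqrt P y = -(((√r : ℝ) : ℂ) • y) := by
      rw [hy, map_sub, map_smul, ← mul_apply_eq_comp, CFC.sqrt_mul_sqrt_self P hP, h, smul_sub,
        smul_smul, hrr]
      abel
    have hpos := ((ContinuousLinearMap.nonneg_iff_isPositive _).1
      (CFC.sqrt_nonneg P)).re_inner_nonneg_right y
    rw [hQ, inner_neg_right, inner_smul_right, inner_self_eq_norm_sq_to_K] at hpos
    have hpos' : 0 ≤ ((-(√r * ‖y‖ ^ 2) : ℝ) : ℂ).re := by
      push_cast
      exact hpos
    rw [Complex.ofReal_re] at hpos'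
    have hy0 : ‖y‖ ^ 2 = 0 := by
      nlinarith [mul_nonneg hs.le (sq_nonneg ‖y‖), sq_nonneg ‖y‖]
    exact sub_eq_zero.1 (norm_eq_zero.1 (pow_eq_zero_iff two_ne_zero |>.1 hy0))

lemma reversing_sqrt (e : HilbertBasis ι ℂ H) {ρ : H →L[ℂ] H} (hρ : 0 ≤ ρ)
    (h : Diagonalizes e ρ) : reversing (conjugation e) (CFC.sqrt ρ) = CFC.sqrt ρ := by
  refine reversing_of_apply_basis e fun i => ?_
  obtain ⟨r, hr⟩ := h i
  exact ⟨_, sqrt_apply_of_eigenvector hρ (e.orthonormal.1 i) hr⟩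

/-- If `Θ` fixes `ρ^{1/2}`, applying the trace preserving anti-automorphism `Θ` exchanges the
arguments of the KMS form. -/
lemma opTrace_reversing_swap (e : HilbertBasis ι ℂ H) {ρ : H →L[ℂ] H} (hρ : IsDensityOperator ρ)
    (h : reversing (conjugation e) (CFC.sqrt ρ) = CFC.sqrt ρ) (x y : H →L[ℂ] H) :
    opTrace (CFC.sqrt ρ * reversing (conjugation e) x * CFC.sqrt ρ * y) =
      opTrace (CFC.sqrt ρ * reversing (conjugation e) y * CFC.sqrt ρ * x) := by
  have hA : IsTraceClass (CFC.sqrt ρ * reversing (conjugation e) x * CFC.sqrt ρ * y) :=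
    (isTraceClass_sqrt_mul_mul_sqrt hρ _).mul_right y
  have hrev : reversing (conjugation e)
      (CFC.sqrt ρ * reversing (conjugation e) x * CFC.sqrt ρ * y) =
      reversing (conjugation e) y * (CFC.sqrt ρ * x * CFC.sqrt ρ) := by
    simp only [reversing_mul, reversing_reversing, h, mul_assoc]
  have hA' := (isTraceClass_sqrt_mul_mul_sqrt hρ x).mul_left (reversing (conjugation e) y)
  rw [← hrev] at hA'
  rw [← opTrace_reversing e hA hA', hrev, opTrace_sqrt_mul_mul_sqrt_mul hρ]

lemma IsThetaKMSAdjoint.opTrace_eq_backward (e : HilbertBasis ι ℂ H) {ρ : H →L[ℂ] H}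
    (hρ : IsDensityOperator ρ) (hdiag : Diagonalizes e ρ)
    {Φ ΦΘ : (H →L[ℂ] H) →L[ℂ] (H →L[ℂ] H)} (h : IsThetaKMSAdjoint (conjugation e) ρ Φ ΦΘ)
    (hstar : ∀ x, Φ (star x) = star (Φ x)) (a b : H →L[ℂ] H) :
    opTrace (CFC.sqrt ρ * sandwich (conjugation e) (star a) * CFC.sqrt ρ * ΦΘ b) =
      opTrace (CFC.sqrt ρ * sandwich (conjugation e) (Φ (star a)) * CFC.sqrt ρ * b) := by
  have hs' := reversing_sqrt e hρ.nonneg hdiag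
  have hkms := h (star b) a
  rw [star_star] at hkms
  rw [hstar]
  change opTrace (CFC.sqrt ρ * reversing (conjugation e) a * CFC.sqrt ρ * ΦΘ b) =
    opTrace (CFC.sqrt ρ * reversing (conjugation e) (Φ a) * CFC.sqrt ρ * b)
  rw [opTrace_reversing_swap e hρ hs', ← hkms, opTrace_reversing_swap e hρ hs']

lemma UniformlyContinuousQMS.isCPL1_predual (S : UniformlyContinuousQMS H) (t : ℝ≥0) :
    IsCPL1 (S.predual t) := by
  obtain ⟨φ, hφ⟩ := S.cp t
  exact isCPL1_of_isPredual (S.isPredual t) φ hφ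

lemma UniformlyContinuousQMS.map_star (S : UniformlyContinuousQMS H) (t : ℝ≥0) (x : H →L[ℂ] H) :
    S.T t (star x) = star (S.T t x) := by
  obtain ⟨φ, hφ⟩ := S.cp t
  rw [← hφ, ← hφ, StarHomClass.map_star]

end Backward

end ChoiJamiolkowski

end

theorem mainTheorem8 {H : Type*} [NormedAddCommGroup H] [InnerProductSpace ℂ H] [CompleteSpace H]
    [TopologicalSpace.SeparableSpace H] {ι : Type*} (e : HilbertBasis ι ℂ H)
    (ρ : H →L[ℂ] H) (hρ : IsDensityOperator ρ) :
    -- the forward and the backward state of a completely positive map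
    (∀ (Φs : L1 H →ₗ[ℂ] L1 H) (Φ : (H →L[ℂ] H) →L[ℂ] (H →L[ℂ] H)),
      IsBoundedL1 Φs → IsCPL1 Φs → IsPredual Φs Φ →
        (IsChoiOperator e ρ Φs (choiOperator e ρ Φs) ∧ 0 ≤ choiOperator e ρ Φs ∧
          IsTraceClass (choiOperator e ρ Φs)) ∧
        (∀ a b : H →L[ℂ] H, forwardState e ρ Φs (opTensor a b) =
          opTrace (CFC.sqrt ρ * sandwich (conjugation e) (star a) * CFC.sqrt ρ * Φ b)) ∧
        (∀ (ΦΘs : L1 H →ₗ[ℂ] L1 H) (ΦΘ : (H →L[ℂ] H) →L[ℂ] (H →L[ℂ] H)),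
          IsBoundedL1 ΦΘs → IsCPL1 ΦΘs → IsPredual ΦΘs ΦΘ →
          ChoiJamiolkowski.IsThetaKMSAdjoint (conjugation e) ρ Φ ΦΘ →
            ∀ a b : H →L[ℂ] H, backwardState e ρ ΦΘs (opTensor a b) =
              opTrace (CFC.sqrt ρ * sandwich (conjugation e) (star a) * CFC.sqrt ρ * ΦΘ b))) ∧
    -- the densities of the forward and of the backward state of a quantum Markov semigroup
    (∀ S SΘ : UniformlyContinuousQMS H, IsFaithful ρ → S.IsInvariant ρ →
      S.IsThetaKMSAdjoint (conjugation e) ρ SΘ → ∀ t : ℝ≥0,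
        IsDensityOf (fun a b => opTrace (CFC.sqrt ρ * sandwich (conjugation e) (star a) *
          CFC.sqrt ρ * S.T t b)) (choiOperator e ρ (S.predual t)) ∧
        IsDensityOf (fun a b => opTrace (CFC.sqrt ρ * sandwich (conjugation e) (star a) *
          CFC.sqrt ρ * SΘ.T t b)) (choiOperator e ρ (SΘ.predual t)) ∧
        (Diagonalizes e ρ →
          IsDensityOf (backwardTwoPoint (conjugation e) ρ S t)
            (choiOperator e ρ (SΘ.predual t)))) := by
  refine ⟨fun Φs Φ _ hcp hd => ⟨choiOperator_spec e hρ hcp hd,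
    opTrace_choiOperator_mul_opTensor e hρ hcp hd,
    fun ΦΘs ΦΘ _ hcp' hd' _ => opTrace_choiOperator_mul_opTensor e hρ hcp' hd'⟩,
    fun S SΘ _ _ hkms t => ?_⟩
  have hΘ := isDensityOf_choiOperator e hρ (SΘ.isCPL1_predual t) (SΘ.isPredual t) (SΘ.map_one t)
  refine ⟨isDensityOf_choiOperator e hρ (S.isCPL1_predual t) (S.isPredual t) (S.map_one t), hΘ,
    fun hdiag => ?_⟩
  convert! hΘ using 1
  funext a b
  exact ((hkms t).opTrace_eq_backward e hρ hdiag (S.map_star t) a b).symm
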